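/- Let $G=(V,E)$ be a finite simple undirected graph. A set $M\subseteq V$ is a \emph{module} of $G$ if $N(v_1)\setminus M=N(v_2)\setminus M$ for all $v_1,v_2\in M$, where $N(v)$ denotes the neighbourhood of $v$. The graph $G$ is \emph{module-composed} if there is a bijection $\varphi:V\to\{1,\dots,|V|\}$ such that for every $2\le i\le |V|$ the set of neighbours of $\varphi^{-1}(i)$ among $\varphi^{-1}(1),\dots,\varphi^{-1}(i-1)$ is a module of the induced subgraph $G[\{\varphi^{-1}(1),\dots,\varphi^{-1}(i-1)\}]$. Every module-composed graph is perfect: for every induced subgraph $H$ of $G$, the chromatic number of $H$ equals the size of a maximum clique of $H$. -/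

import Mathlib

namespace SimpleGraph

/-- A set `M` of vertices is a module (homogeneous set) of `G` if all vertices of `M` have the
same neighbourhood outside `M`. -/
def IsModule {V : Type*} (G : SimpleGraph V) (M : Set V) : Prop :=
  ∀ v₁ ∈ M, ∀ v₂ ∈ M, G.neighborSet v₁ \ M = G.neighborSet v₂ \ M

/-- A linear ordering `φ` of the (finite) vertex set is a module-sequence for `G` if the
neighbourhood of each vertex other than the first one, among the vertices preceding it, is a module
of the subgraph induced by these preceding vertices. Positions are counted from `0`. -/
def IsModuleSequence {V : Type*} (G : SimpleGraph V) (φ : V ≃ Fin (Nat.card V)) : Prop :=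
  ∀ i : Fin (Nat.card V), 1 ≤ (i : ℕ) →
    (G.induce {w : V | φ w < i}).IsModule {w | G.Adj (φ.symm i) (w : V)}

/-- A graph is module-composed if it has a module-sequence. -/
def IsModuleComposed {V : Type*} (G : SimpleGraph V) : Prop :=
  ∃ φ : V ≃ Fin (Nat.card V), G.IsModuleSequence φ

/-- A (finite) graph is perfect if in every induced subgraph the chromatic number equals the size
of a maximum clique. -/
def IsPerfect {V : Type*} (G : SimpleGraph V) : Prop :=
  ∀ s : Set V, (G.induce s).chromaticNumber = ((G.induce s).cliqueNum : ℕ∞)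

end SimpleGraph

namespace SimpleGraph

/-! Remove from `S` its last vertex `v`; by strong induction the rest and the module `M` of
neighbours of `v` in it have optimal colourings, with cliques `T` and `K`. If `|T| ≤ |K|`, then `K ∪
{v}` is a clique and `v` gets a new colour. Otherwise `M` is recoloured with the colours on `K`,
which frees one of the `|T|` colours for `v`. -/

/-- The vertex set `S` contains a clique `T` and has a proper colouring with `T.card` colours. -/
def HasOptimalColoring {V : Type*} (G : SimpleGraph V) (S : Finset V) : Prop :=
  ∃ (T : Finset V) (c : V → ℕ), T ⊆ S ∧ G.IsClique (T : Set V) ∧ (∀ x ∈ S, c x < T.card) ∧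
    ∀ x ∈ S, ∀ y ∈ S, G.Adj x y → c x ≠ c y

/-- In a module-sequence, two earlier neighbours of `v` have the same adjacency to every earlier
non-neighbour of `v`. -/
theorem IsModuleSequence.adj_of_adj {V : Type*} {G : SimpleGraph V} {φ : V ≃ Fin (Nat.card V)}
    (h : G.IsModuleSequence φ) {v a b w : V} (ha : φ a < φ v) (hb : φ b < φ v) (hw : φ w < φ v)
    (hva : G.Adj v a) (hvb : G.Adj v b) (hvw : ¬ G.Adj v w) (haw : G.Adj a w) : G.Adj b w := by
  have hpos : 1 ≤ (φ v : ℕ) := by have : (φ a : ℕ) < φ v := ha; omega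
  have key := h (φ v) hpos ⟨a, ha⟩ (by simpa using hva) ⟨b, hb⟩ (by simpa using hvb)
  have hmem := (Set.ext_iff.1 key ⟨w, hw⟩).1 ⟨by simpa using haw, by simpa using hvw⟩
  simpa using hmem.1

/-- An optimal colouring extends to a new vertex `v` whose neighbourhood in the old vertices is a
module that is itself optimally colourable. -/
theorem HasOptimalColoring.insert {V : Type*} [DecidableEq V] {G : SimpleGraph V} {S M : Finset V}
    {v : V} (hv : v ∉ S) (hM : ∀ x, x ∈ M ↔ x ∈ S ∧ G.Adj v x)
    (hmod : ∀ a ∈ M, ∀ b ∈ M, ∀ w ∈ S, w ∉ M → G.Adj a w → G.Adj b w)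
    (hS : G.HasOptimalColoring S) (hMc : G.HasOptimalColoring M) :
    G.HasOptimalColoring (insert v S) := by
  obtain ⟨T, c, hTS, hT, hc, hcp⟩ := hS
  obtain ⟨K, d, hKM, hK, hd, hdp⟩ := hMc
  have hMS : ∀ x ∈ M, x ∈ S := fun x hx => ((hM x).1 hx).1
  have hne : ∀ x ∈ S, x ≠ v := fun x hx h => hv (h ▸ hx)
  rcases le_or_gt T.card K.card with hle | hlt
  · have hvK : v ∉ K := fun h => hv (hMS _ (hKM h))
    have hlt : ∀ x ∈ S, c x < K.card := fun x hx => (hc x hx).trans_le hle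
    refine ⟨Insert.insert v K, Function.update c v K.card,
      Finset.insert_subset_insert _ fun x hx => hMS x (hKM hx), ?_, ?_, ?_⟩
    · rw [Finset.coe_insert]
      exact hK.insert fun b hb _ => ((hM b).1 (hKM hb)).2
    · rw [Finset.card_insert_of_notMem hvK, Finset.forall_mem_insert]
      refine ⟨by simp, fun x hx => ?_⟩
      rw [Function.update_of_ne (hne x hx)]
      exact (hlt x hx).trans (Nat.lt_succ_self _)
    · intro x hxi y hyi hxy
      rcases Finset.mem_insert.1 hxi with rfl | hx <;> rcases Finset.mem_insert.1 hyi with rfl | hy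
      · exact (G.irrefl hxy).elim
      · rw [Function.update_self, Function.update_of_ne (hne y hy)]
        exact (hlt y hy).ne'
      · rw [Function.update_self, Function.update_of_ne (hne x hx)]
        exact (hlt x hx).ne
      · rw [Function.update_of_ne (hne x hx), Function.update_of_ne (hne y hy)]
        exact hcp x hx y hy hxy
  · have hKS : ∀ x ∈ K, x ∈ S := fun x hx => hMS x (hKM hx)
    have hinj : Set.InjOn c (K : Set V) := fun x hx y hy hxy => by
      by_contra hn
      exact hcp x (hKS x hx) y (hKS y hy) (hK hx hy hn) hxy
    -- The colour for `v`: after the recolouring, `M` uses only colours from `c(K)`.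
    obtain ⟨k, hkT, hk⟩ : ∃ k ∈ Finset.range T.card, k ∉ K.image c :=
      Finset.exists_mem_notMem_of_card_lt_card (by
        rw [Finset.card_range]
        exact Finset.card_image_le.trans_lt hlt)
    -- recolour `M` by the colours that `c` uses on the clique `K`
    let t : ∀ x ∈ M, K := fun x hx => K.equivFin.symm ⟨d x, hd x hx⟩
    have ht : ∀ x hx y hy, c (t x hx) = c (t y hy) → d x = d y := fun x hx y hy h => by
      have := K.equivFin.symm.injective (Subtype.ext (hinj (t x hx).2 (t y hy).2 h))
      simpa using this
    let e : V → ℕ := fun x => if hx : x ∈ M then c (t x hx) else if x = v then k else c x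
    have heM : ∀ x (hx : x ∈ M), e x = c (t x hx) := fun x hx => dif_pos hx
    have hev : e v = k := by
      have : v ∉ M := fun h => hv (hMS v h)
      simp [e, this]
    have heS : ∀ x ∈ S, x ∉ M → e x = c x := fun x hx hxM => by simp [e, hxM, hne x hx]
    have hvx : ∀ x ∈ S, G.Adj v x → k ≠ e x := fun x hx hvx h => by
      have hxM := (hM x).2 ⟨hx, hvx⟩
      exact hk (Finset.mem_image.2 ⟨t x hxM, (t x hxM).2, by rw [h, heM x hxM]⟩)
    -- A neighbour `y` of `x` outside `M` is adjacent to all of `M`, hence to the vertex of `K`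
    -- whose colour `x` takes.
    have hMx : ∀ x ∈ M, ∀ y ∈ S, y ∉ M → G.Adj x y → e x ≠ e y := fun x hx y hy hyM hxy => by
      rw [heM x hx, heS y hy hyM]
      exact hcp _ (hKS _ (t x hx).2) y hy (hmod x hx _ (hKM (t x hx).2) y hy hyM hxy)
    refine ⟨T, e, hTS.trans (Finset.subset_insert _ _), hT, ?_, ?_⟩
    · rw [Finset.forall_mem_insert, hev]
      refine ⟨Finset.mem_range.1 hkT, fun x hx => ?_⟩
      by_cases hxM : x ∈ M
      · rw [heM x hxM]
        exact hc _ (hKS _ (t x hxM).2)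
      · rw [heS x hx hxM]
        exact hc x hx
    · intro x hxi y hyi hxy
      rcases Finset.mem_insert.1 hxi with rfl | hx <;> rcases Finset.mem_insert.1 hyi with rfl | hy
      · exact (G.irrefl hxy).elim
      · rw [hev]
        exact hvx y hy hxy
      · rw [hev]
        exact (hvx x hx hxy.symm).symm
      · by_cases hxM : x ∈ M <;> by_cases hyM : y ∈ M
        · rw [heM x hxM, heM y hyM]
          exact fun h => hdp x hxM y hyM hxy (ht x hxM y hyM h)
        · exact hMx x hxM y hy hyM hxy
        · exact (hMx y hyM x hx hxM hxy.symm).symm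
        · rw [heS x hx hxM, heS y hy hyM]
          exact hcp x hx y hy hxy

/-- In a graph with a module-sequence every finite vertex set is optimally colourable. -/
theorem IsModuleSequence.hasOptimalColoring {V : Type*} {G : SimpleGraph V}
    {φ : V ≃ Fin (Nat.card V)} (h : G.IsModuleSequence φ) (S : Finset V) :
    G.HasOptimalColoring S := by
  classical
  -- Strong induction, since the neighbourhood of `v` in `S` is needed as well as `S.erase v`.
  induction S using Finset.strongInduction with
  | H S ih =>
    rcases S.eq_empty_or_nonempty with rfl | hne
    · exact ⟨∅, fun _ => 0, by simp⟩
    obtain ⟨v, hvS, hmax⟩ := S.exists_max_image φ hne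
    have hss : S.erase v ⊂ S := Finset.erase_ssubset hvS
    have hlt : ∀ x ∈ S.erase v, φ x < φ v := fun x hx =>
      lt_of_le_of_ne (hmax x (Finset.mem_of_mem_erase hx))
        fun he => Finset.ne_of_mem_erase hx (φ.injective he)
    have hM : ∀ x, x ∈ (S.erase v).filter (G.Adj v) ↔ x ∈ S.erase v ∧ G.Adj v x :=
      fun x => Finset.mem_filter
    rw [← Finset.insert_erase hvS]
    refine HasOptimalColoring.insert (Finset.notMem_erase v S) hM ?_ (ih _ hss)
      (ih _ ((Finset.filter_subset _ _).trans_ssubset hss))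
    intro a ha b hb w hw hwM haw
    rw [hM] at ha hb hwM
    exact h.adj_of_adj (hlt a ha.1) (hlt b hb.1) (hlt w hw) ha.2 hb.2 (fun hvw => hwM ⟨hw, hvw⟩) haw

/-- An optimal colouring shows that chromatic number and clique number of the induced subgraph
agree. -/
theorem HasOptimalColoring.chromaticNumber_eq_cliqueNum {V : Type*} [Finite V] {G : SimpleGraph V}
    {S : Finset V} (h : G.HasOptimalColoring S) :
    (G.induce (S : Set V)).chromaticNumber = ((G.induce (S : Set V)).cliqueNum : ℕ∞) := by
  classical
  obtain ⟨T, c, hTS, hT, hc, hcp⟩ := h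
  apply le_antisymm
  · have hcol : (G.induce (S : Set V)).Colorable T.card :=
      ⟨Coloring.mk (fun x => (⟨c x, hc x x.2⟩ : Fin T.card)) fun {x y} hxy hh =>
        hcp x x.2 y y.2 hxy (congrArg Fin.val hh)⟩
    have hclique : (G.induce (S : Set V)).IsClique
        (T.subtype (· ∈ (S : Set V)) : Finset (S : Set V)) := fun x hx y hy hxy => by
      simp only [Finset.mem_coe, Finset.mem_subtype] at hx hy
      exact hT hx hy fun he => hxy (Subtype.ext he)
    have hcard : (T.subtype (· ∈ (S : Set V))).card = T.card := by
      rw [Finset.card_subtype, Finset.filter_true_of_mem fun x hx => Finset.mem_coe.2 (hTS hx)]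
    refine hcol.chromaticNumber_le.trans ?_
    rw [← hcard]
    exact_mod_cast hclique.card_le_cliqueNum
  · obtain ⟨K, hK⟩ := (G.induce (S : Set V)).exists_isNClique_cliqueNum
    rw [← hK.card_eq]
    exact hK.isClique.card_le_chromaticNumber

end SimpleGraph

theorem mainTheorem6 {V : Type*} [Finite V] (G : SimpleGraph V) (hG : G.IsModuleComposed) :
    G.IsPerfect := by
  obtain ⟨φ, hφ⟩ := hG
  intro s
  have h := (hφ.hasOptimalColoring s.toFinite.toFinset).chromaticNumber_eq_cliqueNum
  rwa [Set.Finite.coe_toFinset] at h
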